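/- Let $\mathcal U$ and $\mathcal Y$ be real Hilbert spaces and let $\mathcal B(\mathcal Y)$ be the bounded linear operators on $\mathcal Y$. A mapping $K:\mathcal U\times\mathcal U\to\mathcal B(\mathcal Y)$ is called *symmetric* if $K(u,v)^*=K(v,u)$ for all $u,v\in\mathcal U$; *positive semidefinite* if $\sum_{i=1}^n\sum_{j=1}^n\langle y_i,K(u_i,u_j)y_j\rangle_{\mathcal Y}\ge 0$ for all $n\in\mathbb N$, $u_1,\dots,u_n\in\mathcal U$ and $y_1,\dots,y_n\in\mathcal Y$; and *nonexpansive* if $$\|K(u,u)-K(u,v)-K(v,u)+K(v,v)\|_{\mathcal B(\mathcal Y)}^{1/2}\le\|u-v\|_{\mathcal U}\qquad\text{for all }u,v\in\mathcal U.$$ A scalar-valued kernel $k:\mathcal U\times\mathcal U\to\mathbb R$ is regarded as a kernel with values in $\mathcal B(\mathbb R)$, real numbers acting on $\mathbb R$ by multiplication. The following scalar-valued kernels on $\mathcal U$ are symmetric positive semidefinite and nonexpansive: - the bilinear kernel $k(u,v)=\langle u,v\rangle_{\mathcal U}$; - the Gaussian kernel $k(u,v)=e^{-\|u-v\|_{\mathcal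 U}^2/\sigma^2}$, whenever $\sigma\ge\sqrt2$; - the scaled Laplacian kernel $k(u,v)=(1+\|u-v\|_{\mathcal U})\,e^{-\|u-v\|_{\mathcal U}}$; - the kernel $k(u,v)=(c+\|u-v\|_{\mathcal U}^2)^{-d}$, whenever $c\ge0$ and $d>0$ are real numbers with $2d\le c^{d+1}$. In addition, $K:\mathcal U\times\mathcal U\to\mathcal B(\mathcal Y)$ is symmetric positive semidefinite and nonexpansive in each of the following cases: - $K(u,v)=k(u,v)R$, where $k:\mathcal U\times\mathcal U\to\mathbb R$ is symmetric positive semidefinite and nonexpansive, and $R\in\mathcal B(\mathcal Y)$ is self-adjoint with $\langle y,Ry\rangle_{\mathcal Y}\ge0$ for all $y\in\mathcal Y$ and $\|R\|_{\mathcal B(\mathcal Y)}\le1$; - $K(u,v)=\sum_{i=1}^r\alpha_iK_i(u,v)$, where each $K_i:\mathcal U\times\mathcal U\to\mathcal B(\mathcal Y)$ is symmetric positive semidefinite and nonexpansive, $\alpha_i\ge0$ for $i=1,\dots,r$, and $\sum_{i=1}^r\alpha_i\le1$; - $K(u,v)=R\,L(u,v)\,R^*$, where $R\in\mathcal B(\mathcal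 Y)$ satisfies $\|R\|_{\mathcal B(\mathcal Y)}\le1$ and $L$ is a symmetric positive semidefinite and nonexpansive kernel that is either operator-valued, $L:\mathcal U\times\mathcal U\to\mathcal B(\mathcal Y)$, or scalar-valued, $L:\mathcal U\times\mathcal U\to\mathbb R$ (in which case the number $L(u,v)$ acts on $\mathcal Y$ as a multiple of the identity). -/

import Mathlib

/-- An operator-valued mapping `K : U × U → B(Y)` on real Hilbert spaces is symmetric if
`K(u,v)* = K(v,u)` for all `u, v`. -/
def IsSymmetricKernel {U Y : Type*} [NormedAddCommGroup Y] [InnerProductSpace ℝ Y]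
    [CompleteSpace Y] (K : U → U → (Y →L[ℝ] Y)) : Prop :=
  ∀ u v : U, ContinuousLinearMap.adjoint (K u v) = K v u

/-- `K : U × U → B(Y)` is positive semidefinite if `∑ i, ∑ j, ⟪y i, K(u i, u j) (y j)⟫ ≥ 0`
for all finite families `u i` of points of `U` and `y i` of vectors of `Y`. -/
def IsPosSemidefKernel {U Y : Type*} [NormedAddCommGroup Y] [InnerProductSpace ℝ Y]
    (K : U → U → (Y →L[ℝ] Y)) : Prop :=
  ∀ (n : ℕ) (u : Fin n → U) (y : Fin n → Y),
    0 ≤ ∑ i : Fin n, ∑ j : Fin n, inner ℝ (y i) (K (u i) (u j) (y j))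

/-- `K : U × U → B(Y)` is symmetric positive semidefinite. -/
def IsSymmPosSemidefKernel {U Y : Type*} [NormedAddCommGroup Y] [InnerProductSpace ℝ Y]
    [CompleteSpace Y] (K : U → U → (Y →L[ℝ] Y)) : Prop :=
  IsSymmetricKernel K ∧ IsPosSemidefKernel K

/-- `K : U × U → B(Y)` is nonexpansive if
`‖K(u,u) - K(u,v) - K(v,u) + K(v,v)‖^(1/2) ≤ ‖u - v‖` for all `u, v`
(operator norm on the left). -/
def IsNonexpansiveKernel {U Y : Type*} [NormedAddCommGroup U]
    [NormedAddCommGroup Y] [InnerProductSpace ℝ Y] (K : U → U → (Y →L[ℝ] Y)) : Prop :=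
  ∀ u v : U, Real.sqrt ‖K u u - K u v - K v u + K v v‖ ≤ ‖u - v‖

/-- A scalar-valued kernel `k : U × U → ℝ`, viewed as a kernel with values in `B(ℝ)`:
the number `k(u,v)` acts on `ℝ` by multiplication. -/
noncomputable def scalarKernel {U : Type*} (k : U → U → ℝ) : U → U → (ℝ →L[ℝ] ℝ) :=
  fun u v => k u v • ContinuousLinearMap.id ℝ ℝ

open MeasureTheory Set Filter Topology

/-! A scalar kernel is positive semidefinite when its matrices on finite point sets are, so Schur
products, entrywise exponentials and mixtures (integrals) of such matrices are the tools. Gaussians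
come from exponentiating a Gram matrix; the powers `(c + r²)^(-d)` are Gamma mixtures of Gaussians.
The Laplacian kernel is a mixture of `exp (-√(y + r²))`: the square root is conditionally negative
by an integral representation in terms of `(t + y + r²)⁻¹`, and Schoenberg's theorem exponentiates
it. For a radial kernel `φ(‖u - v‖)`, nonexpansiveness says `2 |φ 0 - φ t| ≤ t²`, a one-variable
estimate. The closure rules use the Schur product, the triangle inequality and submultiplicativity
of the operator norm. -/

/-! ### Real positive semidefinite matrices and entrywise operations -/

theorem Matrix.posSemidef_real_iff {ι : Type*} [Fintype ι] (M : Matrix ι ι ℝ) :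
    M.PosSemidef ↔ (∀ i j, M i j = M j i) ∧ ∀ x : ι → ℝ, 0 ≤ ∑ i, ∑ j, x i * x j * M i j := by
  rw [Matrix.posSemidef_iff_dotProduct_mulVec]
  refine and_congr ⟨fun h i j => by simpa using (h.apply i j).symm,
    fun h => Matrix.IsHermitian.ext fun i j => by simpa using h j i⟩ ?_
  refine forall_congr' fun x => ?_
  have : star x ⬝ᵥ M.mulVec x = ∑ i, ∑ j, x i * x j * M i j := by
    simp only [dotProduct, Matrix.mulVec, Finset.mul_sum, star_trivial]
    exact Finset.sum_congr rfl fun i _ => Finset.sum_congr rfl fun j _ => by ring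
  rw [this]

theorem Matrix.PosSemidef.real_sum_nonneg {ι : Type*} [Fintype ι] {M : Matrix ι ι ℝ}
    (hM : M.PosSemidef) (x : ι → ℝ) : 0 ≤ ∑ i, ∑ j, x i * x j * M i j :=
  ((Matrix.posSemidef_real_iff M).1 hM).2 x

theorem Matrix.PosSemidef.real_symm {ι : Type*} [Fintype ι] {M : Matrix ι ι ℝ}
    (hM : M.PosSemidef) (i j : ι) : M i j = M j i :=
  ((Matrix.posSemidef_real_iff M).1 hM).1 i j

/-- A congruence of a positive semidefinite matrix by a diagonal matrix is positive
semidefinite. -/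
theorem Matrix.PosSemidef.mul_mul_of {ι : Type*} [Fintype ι] {M : Matrix ι ι ℝ}
    (hM : M.PosSemidef) (f : ι → ℝ) :
    (Matrix.of fun i j => f i * f j * M i j).PosSemidef := by
  rw [Matrix.posSemidef_real_iff]
  refine ⟨fun i j => by simp [hM.real_symm i j, mul_comm (f i)], fun x => ?_⟩
  refine (hM.real_sum_nonneg fun i => x i * f i).trans_eq
    (Finset.sum_congr rfl fun i _ => Finset.sum_congr rfl fun j _ => ?_)
  simp only [Matrix.of_apply]
  ring

/-- Integrals of families of positive semidefinite matrices are positive semidefinite. -/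
theorem Matrix.posSemidef_integral {ι α : Type*} [Fintype ι] [MeasurableSpace α]
    {μ : Measure α} {F : α → Matrix ι ι ℝ} (hint : ∀ i j, Integrable (fun t => F t i j) μ)
    (hF : ∀ᵐ t ∂μ, (F t).PosSemidef) :
    (Matrix.of fun i j => ∫ t, F t i j ∂μ).PosSemidef := by
  rw [Matrix.posSemidef_real_iff]
  refine ⟨fun i j => integral_congr_ae (hF.mono fun t ht => ht.real_symm i j), fun x => ?_⟩
  have : ∑ i, ∑ j, x i * x j * (Matrix.of fun i j => ∫ t, F t i j ∂μ) i j
      = ∫ t, ∑ i, ∑ j, x i * x j * F t i j ∂μ := by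
    rw [integral_finsetSum _ fun i _ => integrable_finsetSum _ fun j _ => (hint i j).const_mul _]
    refine Finset.sum_congr rfl fun i _ => ?_
    rw [integral_finsetSum _ fun j _ => (hint i j).const_mul _]
    simp [integral_const_mul]
  rw [this]
  exact integral_nonneg_of_ae (hF.mono fun t ht => ht.real_sum_nonneg x)

theorem Matrix.PosSemidef.hadamard_pow {ι : Type*} [Fintype ι] {M : Matrix ι ι ℝ}
    (hM : M.PosSemidef) (n : ℕ) : (Matrix.of fun i j => M i j ^ n).PosSemidef := by
  induction n with
  | zero =>
    rw [Matrix.posSemidef_real_iff]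
    refine ⟨fun i j => by simp, fun x => ?_⟩
    have : ∑ i, ∑ j, x i * x j * (Matrix.of fun i j => M i j ^ 0) i j = (∑ i, x i) ^ 2 := by
      simp [sq, Finset.sum_mul_sum]
    rw [this]
    positivity
  | succ n ih =>
    have : (Matrix.of fun i j => M i j ^ (n + 1)) =
        Matrix.hadamard (Matrix.of fun i j => M i j ^ n) M := by
      ext i j
      simp [pow_succ]
    rw [this]
    exact ih.hadamard hM

/-- The entrywise exponential of a positive semidefinite matrix is positive semidefinite. -/
theorem Matrix.PosSemidef.hadamard_exp {ι : Type*} [Fintype ι] {M : Matrix ι ι ℝ}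
    (hM : M.PosSemidef) : (Matrix.of fun i j => Real.exp (M i j)).PosSemidef := by
  rw [Matrix.posSemidef_real_iff]
  refine ⟨fun i j => by simp [hM.real_symm i j], fun x => ?_⟩
  have h : HasSum (fun n : ℕ => ∑ i, ∑ j, x i * x j * (M i j ^ n / n.factorial))
      (∑ i, ∑ j, x i * x j * Real.exp (M i j)) := by
    refine hasSum_sum fun i _ => hasSum_sum fun j _ => HasSum.mul_left _ ?_
    rw [Real.exp_eq_exp_ℝ]
    exact NormedSpace.expSeries_div_hasSum_exp (M i j)
  refine h.nonneg fun n => ?_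
  have : ∑ i, ∑ j, x i * x j * (M i j ^ n / n.factorial)
      = (∑ i, ∑ j, x i * x j * M i j ^ n) / n.factorial := by
    simp only [Finset.sum_div, mul_div_assoc]
  rw [this]
  exact div_nonneg ((hM.hadamard_pow n).real_sum_nonneg x) (by positivity)

/-! ### Positive semidefinite functions of the distance -/

section DistanceKernels

variable {ι U : Type*} [Fintype ι] [NormedAddCommGroup U] [InnerProductSpace ℝ U]

/-- Expanding the square leaves `exp (2s⟪u i, u j⟫)`, the exponential of a Gram matrix, up to a
diagonal congruence. -/
theorem posSemidef_exp_neg_mul_norm_sub_sq (u : ι → U) {s : ℝ} (hs : 0 ≤ s) :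
    (Matrix.of fun i j => Real.exp (-(s * ‖u i - u j‖ ^ 2))).PosSemidef := by
  have h := ((Matrix.posSemidef_gram ℝ u).smul (a := 2 * s) (by positivity)).hadamard_exp.mul_mul_of
    fun i => Real.exp (-(s * ‖u i‖ ^ 2))
  convert h using 1
  ext i j
  simp only [Matrix.of_apply, Matrix.smul_apply, Matrix.gram_apply, ← Real.exp_add, smul_eq_mul,
    norm_sub_sq_real]
  ring_nf

theorem Real.integrableOn_rpow_mul_exp_neg_mul_Ioi {a r : ℝ} (ha : 0 < a) (hr : 0 < r) :
    IntegrableOn (fun t : ℝ => t ^ (a - 1) * Real.exp (-(r * t))) (Ioi 0) := by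
  -- A non-integrable function has integral `0` by convention, but the Gamma integral is positive.
  by_contra h
  have h1 := Real.integral_rpow_mul_exp_neg_mul_Ioi ha hr
  rw [integral_undef h] at h1
  have : 0 < (1 / r) ^ a * Real.Gamma a :=
    mul_pos (Real.rpow_pos_of_pos (by positivity) _) (Real.Gamma_pos_of_pos ha)
  linarith

/-- `Γ(d) r^(-d) = ∫ t^(d-1) e^(-rt) dt` with `r = c + ‖u i - u j‖²` is a mixture of Gaussians with
positive weights. -/
theorem posSemidef_add_norm_sub_sq_rpow_neg (u : ι → U) {c d : ℝ} (hc : 0 < c) (hd : 0 < d) :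
    (Matrix.of fun i j => (c + ‖u i - u j‖ ^ 2) ^ (-d)).PosSemidef := by
  have hpos : ∀ i j, 0 < c + ‖u i - u j‖ ^ 2 := fun i j => by positivity
  have h := Matrix.posSemidef_integral (μ := volume.restrict (Ioi (0 : ℝ)))
    (F := fun t => Matrix.of fun i j => t ^ (d - 1) * Real.exp (-((c + ‖u i - u j‖ ^ 2) * t)))
    (fun i j => Real.integrableOn_rpow_mul_exp_neg_mul_Ioi hd (hpos i j))
    (by
      refine ae_restrict_of_forall_mem measurableSet_Ioi fun t ht => ?_
      have ht : 0 < t := ht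
      convert (posSemidef_exp_neg_mul_norm_sub_sq u ht.le).smul
        (a := t ^ (d - 1) * Real.exp (-(c * t))) (by positivity) using 1
      ext i j
      simp only [Matrix.of_apply, Matrix.smul_apply, smul_eq_mul, mul_assoc, ← Real.exp_add]
      ring_nf)
  convert h.smul (a := (Real.Gamma d)⁻¹) (inv_nonneg.2 (Real.Gamma_pos_of_pos hd).le) using 1
  ext i j
  simp only [Matrix.of_apply, Matrix.smul_apply, smul_eq_mul]
  rw [Real.integral_rpow_mul_exp_neg_mul_Ioi hd (hpos i j), one_div,
    Real.inv_rpow (hpos i j).le, Real.rpow_neg (hpos i j).le]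
  field_simp [(Real.Gamma_pos_of_pos hd).ne']

/-- The kernel `√(a + ‖u - v‖ ^ 2)` is conditionally negative semidefinite. -/
theorem sum_mul_sqrt_add_norm_sub_sq_nonpos (u : ι → U) {a : ℝ} (ha : 0 ≤ a) {x : ι → ℝ}
    (hx : ∑ i, x i = 0) : ∑ i, ∑ j, x i * x j * √(a + ‖u i - u j‖ ^ 2) ≤ 0 := by
  have hp : (1 / 2 : ℝ) ∈ Ioo (0 : ℝ) 1 := by constructor <;> norm_num
  set C := ∫ t in Ioi 0, Real.rpowIntegrand₀₁ (1 / 2) t 1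
  have hC : 0 < C := Real.integral_rpowIntegrand₀₁_one_pos hp
  have hpos : ∀ i j, 0 ≤ a + ‖u i - u j‖ ^ 2 := fun i j => by positivity
  have hint := fun i j => Real.integrableOn_rpowIntegrand₀₁_Ioi hp (hpos i j)
  have key : ∑ i, ∑ j, x i * x j * √(a + ‖u i - u j‖ ^ 2) = C⁻¹ * ∫ t in Ioi 0,
      ∑ i, ∑ j, x i * x j * Real.rpowIntegrand₀₁ (1 / 2) t (a + ‖u i - u j‖ ^ 2) := by
    rw [integral_finsetSum _ fun i _ => integrable_finsetSum _ fun j _ => (hint i j).const_mul _,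
      Finset.mul_sum]
    refine Finset.sum_congr rfl fun i _ => ?_
    rw [integral_finsetSum _ fun j _ => (hint i j).const_mul _, Finset.mul_sum]
    refine Finset.sum_congr rfl fun j _ => ?_
    rw [integral_const_mul, Real.sqrt_eq_rpow, Real.rpow_eq_const_mul_integral hp (hpos i j)]
    ring
  rw [key]
  refine mul_nonpos_of_nonneg_of_nonpos (inv_nonneg.2 hC.le)
    (setIntegral_nonpos measurableSet_Ioi fun t ht => ?_)
  have ht : 0 < t := ht
  have h1 := (posSemidef_add_norm_sub_sq_rpow_neg u (c := t + a) (d := 1)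
    (by positivity) one_pos).real_sum_nonneg x
  -- The integrand is `t^(1/2) (t⁻¹ - (t + z)⁻¹)`. The `t⁻¹` part is killed by `∑ x i = 0`, leaving
  -- minus a positive semidefinite form.
  have h2 : ∑ i, ∑ j, x i * x j * Real.rpowIntegrand₀₁ (1 / 2) t (a + ‖u i - u j‖ ^ 2)
      = t ^ (1 / 2 : ℝ) * (t⁻¹ * ((∑ i, x i) * ∑ j, x j)
        - ∑ i, ∑ j, x i * x j * (t + a + ‖u i - u j‖ ^ 2) ^ (-1 : ℝ)) := by
    rw [Finset.sum_mul_sum]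
    simp only [Finset.mul_sum, ← Finset.sum_sub_distrib]
    refine Finset.sum_congr rfl fun i _ => Finset.sum_congr rfl fun j _ => ?_
    rw [Real.rpowIntegrand₀₁, Real.rpow_neg_one, add_assoc]
    ring
  rw [h2, hx]
  simp only [Matrix.of_apply] at h1
  have h3 : 0 ≤ t ^ (1 / 2 : ℝ) := by positivity
  nlinarith [mul_nonneg h3 h1]

/-- Schoenberg: if `ψ` is conditionally negative semidefinite, then `exp (-ψ)` is positive
semidefinite. -/
theorem posSemidef_exp_neg_of_conditionally_nonpos {ψ : ι → ι → ℝ} (hsymm : ∀ i j, ψ i j = ψ j i)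
    (hψ : ∀ x : ι → ℝ, ∑ i, x i = 0 → ∑ i, ∑ j, x i * x j * ψ i j ≤ 0) :
    (Matrix.of fun i j => Real.exp (-ψ i j)).PosSemidef := by
  classical
  rcases isEmpty_or_nonempty ι with h | ⟨⟨o⟩⟩
  · rw [Matrix.posSemidef_real_iff]
    exact ⟨fun i => h.elim i, fun x => by simp⟩
  have hM : (Matrix.of fun i j => ψ i o + ψ j o - ψ i j - ψ o o).PosSemidef := by
    rw [Matrix.posSemidef_real_iff]
    refine ⟨fun i j => by simp only [Matrix.of_apply, hsymm i j]; ring, fun x => ?_⟩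
    set S := ∑ i, x i with hS
    -- Subtracting the total mass at the base point `o` makes the weights sum to zero; the form of
    -- `ψ` at these weights is minus the form of the centred matrix at `x`.
    have h0 := hψ (fun i => x i - if i = o then S else 0) (by simp [S])
    have h1 : ∑ i, ∑ j, (x i - if i = o then S else 0) * (x j - if j = o then S else 0) * ψ i j
        = ∑ i, ∑ j, x i * x j * ψ i j - S * ∑ i, x i * ψ i o - S * ∑ j, x j * ψ o j
          + S * S * ψ o o := by
      simp only [sub_mul, mul_sub, Finset.sum_sub_distrib, ite_mul, mul_ite, zero_mul, mul_zero,
        Finset.sum_ite_eq', Finset.mem_univ, if_true, Finset.mul_sum]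
      have e1 : ∀ i, x i * S * ψ i o = S * (x i * ψ i o) := fun i => by ring
      have e2 : ∀ i, S * x i * ψ o i = S * (x i * ψ o i) := fun i => by ring
      simp [e1, e2]
      ring
    have h2 : ∑ i, ∑ j, x i * x j * (Matrix.of fun i j => ψ i o + ψ j o - ψ i j - ψ o o) i j
        = S * ∑ i, x i * ψ i o + S * ∑ j, x j * ψ o j - ∑ i, ∑ j, x i * x j * ψ i j
          - S * S * ψ o o := by
      have e1 : S * ∑ i, x i * ψ i o = ∑ i, ∑ j, x i * x j * ψ i o := by
        rw [mul_comm, hS, Finset.sum_mul_sum]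
        exact Finset.sum_congr rfl fun i _ => Finset.sum_congr rfl fun j _ => by ring
      have e2 : S * ∑ j, x j * ψ o j = ∑ i, ∑ j, x i * x j * ψ j o := by
        rw [hS, Finset.sum_mul_sum]
        exact Finset.sum_congr rfl fun i _ => Finset.sum_congr rfl fun j _ => by
          rw [hsymm o j]; ring
      have e3 : S * S * ψ o o = ∑ i, ∑ j, x i * x j * ψ o o := by
        rw [hS, Finset.sum_mul_sum]
        simp only [Finset.sum_mul]
      rw [e1, e2, e3]
      simp only [Matrix.of_apply, mul_sub, mul_add, Finset.sum_add_distrib,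
        Finset.sum_sub_distrib]
    rw [h1] at h0
    linarith
  convert hM.hadamard_exp.mul_mul_of fun i => Real.exp (ψ o o / 2 - ψ i o) using 1
  ext i j
  simp only [Matrix.of_apply, ← Real.exp_add]
  ring_nf

theorem hasDerivAt_one_add_mul_exp_neg (r : ℝ) :
    HasDerivAt (fun r => (1 + r) * Real.exp (-r)) (-(r * Real.exp (-r))) r := by
  refine (((hasDerivAt_id r).const_add 1).mul (hasDerivAt_id r).neg.exp).congr_deriv ?_
  simp
  ring

theorem tendsto_one_add_mul_exp_neg :
    Tendsto (fun r : ℝ => (1 + r) * Real.exp (-r)) atTop (𝓝 0) := by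
  have h1 := Real.tendsto_pow_mul_exp_neg_atTop_nhds_zero 1
  have h0 := Real.tendsto_pow_mul_exp_neg_atTop_nhds_zero 0
  simpa [add_mul] using h0.add h1

/-- With `x = ‖u - v‖²` this writes the Laplacian kernel as a mixture of Schoenberg exponentials.
The antiderivative comes from substituting `r = √(y + x)`. -/
theorem integral_exp_neg_sqrt_add {x : ℝ} (hx : 0 ≤ x) :
    IntegrableOn (fun y => Real.exp (-√(y + x))) (Ioi 0) ∧
      ∫ y in Ioi 0, Real.exp (-√(y + x)) = 2 * ((1 + √x) * Real.exp (-√x)) := by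
  -- Only continuity is asked at `y = 0`, since the inner square root is not differentiable there
  -- when `x = 0`.
  have hcont : ContinuousWithinAt (fun y => -2 * ((1 + √(y + x)) * Real.exp (-√(y + x))))
      (Ici 0) 0 := by
    apply Continuous.continuousWithinAt
    fun_prop
  have hderiv : ∀ y ∈ Ioi (0 : ℝ), HasDerivAt
      (fun y => -2 * ((1 + √(y + x)) * Real.exp (-√(y + x)))) (Real.exp (-√(y + x))) y := by
    intro y hy
    have hy : 0 < y := hy
    have hr : 0 < √(y + x) := Real.sqrt_pos.2 (by positivity)
    have h1 : HasDerivAt (fun y => √(y + x)) (1 / (2 * √(y + x))) y :=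
      ((hasDerivAt_id y).add_const x).sqrt (by simp; positivity)
    refine (((hasDerivAt_one_add_mul_exp_neg (√(y + x))).comp y h1).const_mul (-2)).congr_deriv ?_
    field_simp
  have hlim : Tendsto (fun y => -2 * ((1 + √(y + x)) * Real.exp (-√(y + x)))) atTop (𝓝 0) := by
    have h := (tendsto_one_add_mul_exp_neg.comp (Real.tendsto_sqrt_atTop.comp
      (tendsto_atTop_add_const_right _ x tendsto_id))).const_mul (-2)
    simpa using h
  have hnn : ∀ y ∈ Ioi (0 : ℝ), 0 ≤ Real.exp (-√(y + x)) := fun y _ => (Real.exp_pos _).le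
  refine ⟨integrableOn_Ioi_deriv_of_nonneg hcont hderiv hnn hlim, ?_⟩
  rw [integral_Ioi_of_hasDerivAt_of_nonneg hcont hderiv hnn hlim]
  simp

theorem posSemidef_one_add_norm_sub_mul_exp_neg (u : ι → U) :
    (Matrix.of fun i j => (1 + ‖u i - u j‖) * Real.exp (-‖u i - u j‖)).PosSemidef := by
  have h := Matrix.posSemidef_integral (μ := volume.restrict (Ioi (0 : ℝ)))
    (F := fun y => Matrix.of fun i j => Real.exp (-√(y + ‖u i - u j‖ ^ 2)))
    (fun i j => (integral_exp_neg_sqrt_add (by positivity)).1)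
    (ae_restrict_of_forall_mem measurableSet_Ioi fun y hy =>
      posSemidef_exp_neg_of_conditionally_nonpos (fun i j => by rw [norm_sub_rev])
        fun x hx => sum_mul_sqrt_add_norm_sub_sq_nonpos u (le_of_lt hy) hx)
  convert h.smul (a := (1 / 2 : ℝ)) (by norm_num) using 1
  ext i j
  simp only [Matrix.of_apply, Matrix.smul_apply, smul_eq_mul]
  rw [(integral_exp_neg_sqrt_add (sq_nonneg ‖u i - u j‖)).2, Real.sqrt_sq (norm_nonneg _)]
  ring

end DistanceKernels

/-! ### One-variable estimates for nonexpansiveness -/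

theorem one_sub_sq_div_two_le_one_add_mul_exp_neg {t : ℝ} (ht : 0 ≤ t) :
    1 - t ^ 2 / 2 ≤ (1 + t) * Real.exp (-t) := by
  have hd : ∀ r : ℝ, HasDerivAt (fun r => (1 + r) * Real.exp (-r) + r ^ 2 / 2)
      (-(r * Real.exp (-r)) + r) r := fun r => by
    refine ((hasDerivAt_one_add_mul_exp_neg r).add
      ((hasDerivAt_pow 2 r).div_const 2)).congr_deriv ?_
    simp
  have hmono : MonotoneOn (fun r : ℝ => (1 + r) * Real.exp (-r) + r ^ 2 / 2) (Ici 0) := by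
    refine monotoneOn_of_deriv_nonneg (convex_Ici 0)
      (fun r _ => (hd r).continuousAt.continuousWithinAt)
      (fun r _ => (hd r).differentiableAt.differentiableWithinAt) fun r hr => ?_
    rw [interior_Ici] at hr
    have hr : 0 < r := hr
    rw [(hd r).deriv]
    have : Real.exp (-r) ≤ 1 := Real.exp_le_one_iff.2 (by linarith)
    nlinarith
  have := hmono self_mem_Ici ht ht
  norm_num at this
  linarith

theorem rpow_neg_sub_add_rpow_neg_le {c d x : ℝ} (hc : 0 < c) (hd : 0 < d) (hx : 0 ≤ x)
    (h : 2 * d ≤ c ^ (d + 1)) : 2 * (c ^ (-d) - (c + x) ^ (-d)) ≤ x := by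
  have h1 : (c + x) ^ (-d) = c ^ (-d) * (1 + x / c) ^ (-d) := by
    rw [← Real.mul_rpow hc.le (by positivity)]
    congr 1
    field_simp
  -- Bernoulli's inequality for a negative exponent, from `e^s ≥ 1 + s` and `log p ≤ p - 1`.
  have h2 : 1 - d * (x / c) ≤ (1 + x / c) ^ (-d) := by
    have hp : 0 < 1 + x / c := by positivity
    rw [Real.rpow_def_of_pos hp]
    have h3 := Real.add_one_le_exp (Real.log (1 + x / c) * -d)
    have h4 := Real.log_le_sub_one_of_pos hp
    nlinarith
  have h5 : 0 < c ^ (-d) := Real.rpow_pos_of_pos hc _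
  have h6 : c ^ (-d) * c ^ (d + 1) = c := by
    rw [← Real.rpow_add hc]
    simp
  -- The hypothesis `2d ≤ c^(d+1)` multiplied by `c^(-d)`: it bounds the slope at `x = 0`.
  have h7 : 2 * d * c ^ (-d) ≤ c := by nlinarith
  have h8 : 2 * (c ^ (-d) * (d * (x / c))) ≤ x := by
    have : 2 * (c ^ (-d) * (d * (x / c))) = (2 * d * c ^ (-d)) * (x / c) := by ring
    rw [this]
    calc _ ≤ c * (x / c) := by gcongr
      _ = x := by field_simp
  rw [h1]
  nlinarith [mul_le_mul_of_nonneg_left h2 h5.le]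

/-! ### Scalar and operator-valued kernels, closure rules -/

section Kernels

variable {U Y : Type*}

theorem isSymmPosSemidefKernel_scalarKernel_iff (k : U → U → ℝ) :
    IsSymmPosSemidefKernel (scalarKernel k) ↔
      ∀ (n : ℕ) (u : Fin n → U), (Matrix.of fun i j => k (u i) (u j)).PosSemidef := by
  have hq : ∀ (n : ℕ) (u : Fin n → U) (y : Fin n → ℝ),
      ∑ i, ∑ j, inner ℝ (y i) (scalarKernel k (u i) (u j) (y j))
        = ∑ i, ∑ j, y i * y j * (Matrix.of fun i j => k (u i) (u j)) i j := by
    intro n u y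
    refine Finset.sum_congr rfl fun i _ => Finset.sum_congr rfl fun j _ => ?_
    simp [scalarKernel]
    ring
  have hs : ∀ u v, ContinuousLinearMap.adjoint (scalarKernel k u v) = scalarKernel k u v := by
    intro u v
    simp [scalarKernel, ContinuousLinearMap.adjoint_id]
  constructor
  · rintro ⟨h1, h2⟩ n u
    rw [Matrix.posSemidef_real_iff]
    refine ⟨fun i j => ?_, fun x => hq n u x ▸ h2 n u x⟩
    have := congrArg (fun T => T (1 : ℝ)) ((hs (u i) (u j)).symm.trans (h1 (u i) (u j)))
    simpa [scalarKernel] using this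
  · intro h
    refine ⟨fun u v => ?_, fun n u y => (hq n u y).symm ▸ (h n u).real_sum_nonneg y⟩
    -- Symmetry of `k` is read off its matrix on two points.
    have := (h 2 ![u, v]).real_symm 0 1
    simp at this
    rw [hs, scalarKernel, scalarKernel, this]

theorem isNonexpansiveKernel_iff [NormedAddCommGroup U] [NormedAddCommGroup Y]
    [InnerProductSpace ℝ Y] (K : U → U → (Y →L[ℝ] Y)) :
    IsNonexpansiveKernel K ↔ ∀ u v, ‖K u u - K u v - K v u + K v v‖ ≤ ‖u - v‖ ^ 2 :=
  forall₂_congr fun _ _ => by rw [Real.sqrt_le_left (norm_nonneg _)]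

theorem isNonexpansiveKernel_scalarKernel_iff [NormedAddCommGroup U] (k : U → U → ℝ) :
    IsNonexpansiveKernel (scalarKernel k) ↔
      ∀ u v, |k u u - k u v - k v u + k v v| ≤ ‖u - v‖ ^ 2 := by
  rw [isNonexpansiveKernel_iff]
  refine forall₂_congr fun u v => ?_
  simp only [scalarKernel, ← sub_smul, ← add_smul]
  rw [norm_smul, ContinuousLinearMap.norm_id, mul_one, Real.norm_eq_abs]

theorem isNonexpansiveKernel_scalarKernel_norm_sub [NormedAddCommGroup U] (φ : ℝ → ℝ)
    (h0 : ∀ t, 0 ≤ t → φ t ≤ φ 0) (h1 : ∀ t, 0 ≤ t → 2 * (φ 0 - φ t) ≤ t ^ 2) :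
    IsNonexpansiveKernel (scalarKernel fun u v : U => φ ‖u - v‖) := by
  rw [isNonexpansiveKernel_scalarKernel_iff]
  intro u v
  rw [sub_self, sub_self, norm_zero, norm_sub_rev v u, abs_of_nonneg]
  · linarith [h1 _ (norm_nonneg (u - v))]
  · linarith [h0 _ (norm_nonneg (u - v))]

variable [NormedAddCommGroup Y] [InnerProductSpace ℝ Y]

/-- The double sum is the Schur product of the matrices `k (u i) (u j)` and `⟪y i, R (y j)⟫`, tested
on the all-ones vector. -/
theorem IsSymmPosSemidefKernel.scalar_smul [CompleteSpace Y]
    {k : U → U → ℝ} {R : Y →L[ℝ] Y}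
    (hk : IsSymmPosSemidefKernel (scalarKernel k)) (hR : IsSelfAdjoint R)
    (hR0 : ∀ y : Y, 0 ≤ inner ℝ y (R y)) : IsSymmPosSemidefKernel fun u v : U => k u v • R := by
  rw [isSymmPosSemidefKernel_scalarKernel_iff] at hk
  have hadj : ContinuousLinearMap.adjoint R = R := hR.adjoint_eq
  refine ⟨fun u v => ?_, fun n u y => ?_⟩
  · have := (hk 2 ![u, v]).real_symm 0 1
    simp at this
    simp [hadj, this]
  · have hG : (Matrix.of fun i j => inner ℝ (y i) (R (y j))).PosSemidef := by
      rw [Matrix.posSemidef_real_iff]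
      refine ⟨fun i j => ?_, fun x => ?_⟩
      · simp only [Matrix.of_apply]
        rw [← ContinuousLinearMap.adjoint_inner_left, hadj, real_inner_comm]
      · refine (hR0 (∑ i, x i • y i)).trans_eq ?_
        simp only [map_sum, map_smul, sum_inner]
        refine Finset.sum_congr rfl fun i _ => ?_
        simp only [inner_sum, real_inner_smul_left, real_inner_smul_right, Matrix.of_apply]
        exact Finset.sum_congr rfl fun j _ => by ring
    refine (((hk n u).hadamard hG).real_sum_nonneg 1).trans_eq
      (Finset.sum_congr rfl fun i _ => Finset.sum_congr rfl fun j _ => ?_)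
    simp [inner_smul_right]

theorem IsNonexpansiveKernel.scalar_smul [NormedAddCommGroup U]
    {k : U → U → ℝ} {R : Y →L[ℝ] Y}
    (hk : IsNonexpansiveKernel (scalarKernel k)) (hR : ‖R‖ ≤ 1) :
    IsNonexpansiveKernel fun u v : U => k u v • R := by
  rw [isNonexpansiveKernel_scalarKernel_iff] at hk
  rw [isNonexpansiveKernel_iff]
  intro u v
  rw [← sub_smul, ← sub_smul, ← add_smul, norm_smul, Real.norm_eq_abs]
  exact (mul_le_of_le_one_right (abs_nonneg _) hR).trans (hk u v)

theorem IsSymmPosSemidefKernel.sum_smul [CompleteSpace Y]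
    {r : ℕ} {α : Fin r → ℝ} {K : Fin r → U → U → (Y →L[ℝ] Y)}
    (hK : ∀ i, IsSymmPosSemidefKernel (K i)) (hα : ∀ i, 0 ≤ α i) :
    IsSymmPosSemidefKernel fun u v : U => ∑ i, α i • K i u v := by
  refine ⟨fun u v => ?_, fun n u y => ?_⟩
  · simp only [map_sum, map_smulₛₗ, conj_trivial, (hK _).1 u v]
  · have : ∑ i, ∑ j, inner ℝ (y i) ((∑ l, α l • K l (u i) (u j)) (y j))
        = ∑ l, α l * ∑ i, ∑ j, inner ℝ (y i) (K l (u i) (u j) (y j)) := by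
      simp only [sum_apply, smul_apply, inner_sum,
        inner_smul_right, Finset.mul_sum]
      rw [Finset.sum_comm' (t' := Finset.univ) (s' := fun _ => Finset.univ) (by simp)]
      rw [Finset.sum_comm]
      conv_rhs => rw [Finset.sum_comm]
      refine Finset.sum_congr rfl fun i _ => ?_
      rw [Finset.sum_comm]
    rw [this]
    exact Finset.sum_nonneg fun l _ => mul_nonneg (hα l) ((hK l).2 n u y)

theorem IsNonexpansiveKernel.sum_smul [NormedAddCommGroup U]
    {r : ℕ} {α : Fin r → ℝ} {K : Fin r → U → U → (Y →L[ℝ] Y)}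
    (hK : ∀ i, IsNonexpansiveKernel (K i)) (hα : ∀ i, 0 ≤ α i) (hα1 : ∑ i, α i ≤ 1) :
    IsNonexpansiveKernel fun u v : U => ∑ i, α i • K i u v := by
  rw [isNonexpansiveKernel_iff]
  intro u v
  simp only [← Finset.sum_sub_distrib, ← Finset.sum_add_distrib, ← smul_sub, ← smul_add]
  calc _ ≤ ∑ i, ‖α i • (K i u u - K i u v - K i v u + K i v v)‖ := norm_sum_le _ _
    _ ≤ ∑ i, α i * ‖u - v‖ ^ 2 := by
      refine Finset.sum_le_sum fun i _ => ?_
      rw [norm_smul, Real.norm_of_nonneg (hα i)]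
      exact mul_le_mul_of_nonneg_left ((isNonexpansiveKernel_iff _).1 (hK i) u v) (hα i)
    _ = (∑ i, α i) * ‖u - v‖ ^ 2 := (Finset.sum_mul ..).symm
    _ ≤ ‖u - v‖ ^ 2 := mul_le_of_le_one_left (sq_nonneg _) hα1

theorem IsSymmPosSemidefKernel.conj [CompleteSpace Y]
    {L : U → U → (Y →L[ℝ] Y)} (hL : IsSymmPosSemidefKernel L)
    (R : Y →L[ℝ] Y) :
    IsSymmPosSemidefKernel fun u v : U => R ∘L L u v ∘L ContinuousLinearMap.adjoint R := by
  refine ⟨fun u v => ?_, fun n u y => ?_⟩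
  · simp only [ContinuousLinearMap.adjoint_comp, ContinuousLinearMap.adjoint_adjoint, hL.1 u v,
      ContinuousLinearMap.comp_assoc]
  · refine (hL.2 n u fun i => ContinuousLinearMap.adjoint R (y i)).trans_eq
      (Finset.sum_congr rfl fun i _ => Finset.sum_congr rfl fun j _ => ?_)
    simp [ContinuousLinearMap.adjoint_inner_left]

theorem IsNonexpansiveKernel.conj [NormedAddCommGroup U] [CompleteSpace Y]
    {L : U → U → (Y →L[ℝ] Y)} (hL : IsNonexpansiveKernel L)
    {R : Y →L[ℝ] Y} (hR : ‖R‖ ≤ 1) :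
    IsNonexpansiveKernel fun u v : U => R ∘L L u v ∘L ContinuousLinearMap.adjoint R := by
  rw [isNonexpansiveKernel_iff] at hL ⊢
  intro u v
  have hR' : ‖ContinuousLinearMap.adjoint R‖ ≤ 1 := by simpa using hR
  simp only [← ContinuousLinearMap.comp_sub, ← ContinuousLinearMap.comp_add,
    ← ContinuousLinearMap.sub_comp, ← ContinuousLinearMap.add_comp]
  refine le_trans ?_ (hL u v)
  refine (ContinuousLinearMap.opNorm_comp_le _ _).trans
    ((mul_le_of_le_one_left (norm_nonneg _) hR).trans ?_)
  exact (ContinuousLinearMap.opNorm_comp_le _ _).trans (mul_le_of_le_one_right (norm_nonneg _) hR')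

theorem isNonexpansiveKernel_inner [NormedAddCommGroup U] [InnerProductSpace ℝ U] :
    IsNonexpansiveKernel (scalarKernel fun u v : U => inner ℝ u v) := by
  rw [isNonexpansiveKernel_scalarKernel_iff]
  intro u v
  have : inner ℝ u u - inner ℝ u v - inner ℝ v u + inner ℝ v v = ‖u - v‖ ^ 2 := by
    rw [← real_inner_self_eq_norm_sq, inner_sub_left, inner_sub_right, inner_sub_right]
    ring
  rw [this, abs_of_nonneg (sq_nonneg _)]

/-- `2 (1 - e^(-t²/σ²)) ≤ 2t²/σ²`, which is at most `t²` because `σ² ≥ 2`. -/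
theorem isNonexpansiveKernel_exp_neg_norm_sub_sq_div [NormedAddCommGroup U]
    {σ : ℝ} (hσ : √2 ≤ σ) :
    IsNonexpansiveKernel
      (scalarKernel fun u v : U => Real.exp (-(‖u - v‖ ^ 2 / σ ^ 2))) := by
  have h2 : 2 ≤ σ ^ 2 := by
    rw [← Real.sq_sqrt (zero_le_two (α := ℝ))]
    gcongr
  refine isNonexpansiveKernel_scalarKernel_norm_sub (fun t => Real.exp (-(t ^ 2 / σ ^ 2)))
    (fun t _ => ?_) fun t _ => ?_
  · simp
    positivity
  · have h3 := Real.add_one_le_exp (-(t ^ 2 / σ ^ 2))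
    have h4 : t ^ 2 / σ ^ 2 ≤ t ^ 2 / 2 := by gcongr
    simp
    linarith

theorem isNonexpansiveKernel_one_add_norm_sub_mul_exp_neg [NormedAddCommGroup U] :
    IsNonexpansiveKernel
      (scalarKernel fun u v : U => (1 + ‖u - v‖) * Real.exp (-‖u - v‖)) := by
  refine isNonexpansiveKernel_scalarKernel_norm_sub (fun t => (1 + t) * Real.exp (-t))
    (fun t _ => ?_) fun t ht => ?_
  · have h1 := Real.add_one_le_exp t
    have h2 : Real.exp t * Real.exp (-t) = 1 := by simp [← Real.exp_add]
    have h3 := Real.exp_pos (-t)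
    simp
    nlinarith
  · have := one_sub_sq_div_two_le_one_add_mul_exp_neg ht
    simp
    linarith

theorem isNonexpansiveKernel_add_norm_sub_sq_rpow_neg [NormedAddCommGroup U]
    {c d : ℝ} (hc : 0 < c) (hd : 0 < d)
    (h : 2 * d ≤ c ^ (d + 1)) :
    IsNonexpansiveKernel (scalarKernel fun u v : U => (c + ‖u - v‖ ^ 2) ^ (-d)) := by
  refine isNonexpansiveKernel_scalarKernel_norm_sub (fun t => (c + t ^ 2) ^ (-d))
    (fun t _ => ?_) fun t _ => ?_
  · refine Real.rpow_le_rpow_of_nonpos (by positivity) ?_ (by linarith)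
    simp
    positivity
  · simpa using rpow_neg_sub_add_rpow_neg_le hc hd (sq_nonneg t) h

end Kernels

theorem mainTheorem2
    {U Y : Type*}
    [NormedAddCommGroup U] [InnerProductSpace ℝ U] [CompleteSpace U]
    [NormedAddCommGroup Y] [InnerProductSpace ℝ Y] [CompleteSpace Y] :
    -- the bilinear kernel
    (IsSymmPosSemidefKernel (scalarKernel fun u v : U => inner ℝ u v) ∧
      IsNonexpansiveKernel (scalarKernel fun u v : U => inner ℝ u v)) ∧
    -- the Gaussian kernel
    (∀ σ : ℝ, Real.sqrt 2 ≤ σ →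
      IsSymmPosSemidefKernel
        (scalarKernel fun u v : U => Real.exp (-(‖u - v‖ ^ 2 / σ ^ 2))) ∧
      IsNonexpansiveKernel
        (scalarKernel fun u v : U => Real.exp (-(‖u - v‖ ^ 2 / σ ^ 2)))) ∧
    -- the scaled Laplacian kernel
    (IsSymmPosSemidefKernel
        (scalarKernel fun u v : U => (1 + ‖u - v‖) * Real.exp (-‖u - v‖)) ∧
      IsNonexpansiveKernel
        (scalarKernel fun u v : U => (1 + ‖u - v‖) * Real.exp (-‖u - v‖))) ∧
    -- the kernel `(c + ‖u - v‖ ^ 2) ^ (-d)`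
    (∀ c d : ℝ, 0 ≤ c → 0 < d → 2 * d ≤ c ^ (d + 1) →
      IsSymmPosSemidefKernel (scalarKernel fun u v : U => (c + ‖u - v‖ ^ 2) ^ (-d)) ∧
      IsNonexpansiveKernel (scalarKernel fun u v : U => (c + ‖u - v‖ ^ 2) ^ (-d))) ∧
    -- a scalar-valued kernel times a positive operator
    (∀ (k : U → U → ℝ) (R : Y →L[ℝ] Y),
      IsSymmPosSemidefKernel (scalarKernel k) → IsNonexpansiveKernel (scalarKernel k) →
      IsSelfAdjoint R → (∀ y : Y, 0 ≤ inner ℝ y (R y)) → ‖R‖ ≤ 1 →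
      IsSymmPosSemidefKernel (fun u v : U => k u v • R) ∧
      IsNonexpansiveKernel (fun u v : U => k u v • R)) ∧
    -- nonnegative combinations of total weight at most one
    (∀ (r : ℕ) (α : Fin r → ℝ) (K : Fin r → U → U → (Y →L[ℝ] Y)),
      (∀ i, IsSymmPosSemidefKernel (K i)) → (∀ i, IsNonexpansiveKernel (K i)) →
      (∀ i, 0 ≤ α i) → ∑ i, α i ≤ 1 →
      IsSymmPosSemidefKernel (fun u v : U => ∑ i, α i • K i u v) ∧
      IsNonexpansiveKernel (fun u v : U => ∑ i, α i • K i u v)) ∧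
    -- conjugation of an operator-valued kernel
    (∀ (L : U → U → (Y →L[ℝ] Y)) (R : Y →L[ℝ] Y),
      IsSymmPosSemidefKernel L → IsNonexpansiveKernel L → ‖R‖ ≤ 1 →
      IsSymmPosSemidefKernel
        (fun u v : U => R ∘L L u v ∘L ContinuousLinearMap.adjoint R) ∧
      IsNonexpansiveKernel
        (fun u v : U => R ∘L L u v ∘L ContinuousLinearMap.adjoint R)) ∧
    -- conjugation of a scalar-valued kernel, `L(u,v)` acting on `Y` as a multiple of the identity
    (∀ (L : U → U → ℝ) (R : Y →L[ℝ] Y),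
      IsSymmPosSemidefKernel (scalarKernel L) → IsNonexpansiveKernel (scalarKernel L) →
      ‖R‖ ≤ 1 →
      IsSymmPosSemidefKernel
        (fun u v : U =>
          R ∘L (L u v • ContinuousLinearMap.id ℝ Y) ∘L ContinuousLinearMap.adjoint R) ∧
      IsNonexpansiveKernel
        (fun u v : U =>
          R ∘L (L u v • ContinuousLinearMap.id ℝ Y) ∘L ContinuousLinearMap.adjoint R)) := by
  have hconj (R : Y →L[ℝ] Y) : IsSelfAdjoint (R ∘L ContinuousLinearMap.adjoint R) ∧
      ∀ y : Y, 0 ≤ inner ℝ y ((R ∘L ContinuousLinearMap.adjoint R) y) := by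
    refine ⟨?_, fun y => ?_⟩
    · rw [ContinuousLinearMap.isSelfAdjoint_iff']
      simp [ContinuousLinearMap.adjoint_comp]
    · rw [ContinuousLinearMap.comp_apply, ← ContinuousLinearMap.adjoint_inner_left]
      exact real_inner_self_nonneg
  have hcomp (a : ℝ) (R : Y →L[ℝ] Y) :
      R ∘L (a • ContinuousLinearMap.id ℝ Y) ∘L ContinuousLinearMap.adjoint R
        = a • (R ∘L ContinuousLinearMap.adjoint R) := by
    ext y
    simp
  refine ⟨⟨?_, isNonexpansiveKernel_inner⟩,
    fun σ hσ => ⟨?_, isNonexpansiveKernel_exp_neg_norm_sub_sq_div hσ⟩,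
    ⟨?_, isNonexpansiveKernel_one_add_norm_sub_mul_exp_neg⟩, fun c d hc hd h => ?_,
    fun k R hk hk' hR hR0 hR1 => ⟨hk.scalar_smul hR hR0, hk'.scalar_smul hR1⟩,
    fun r α K hK hK' hα hα1 => ⟨.sum_smul hK hα, .sum_smul hK' hα hα1⟩,
    fun L R hL hL' hR => ⟨hL.conj R, hL'.conj hR⟩, fun L R hL hL' hR => ?_⟩
  · rw [isSymmPosSemidefKernel_scalarKernel_iff]
    exact fun n u => Matrix.posSemidef_gram ℝ u
  · rw [isSymmPosSemidefKernel_scalarKernel_iff]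
    intro n u
    simpa only [div_eq_inv_mul] using
      posSemidef_exp_neg_mul_norm_sub_sq u (inv_nonneg.2 (sq_nonneg σ))
  · rw [isSymmPosSemidefKernel_scalarKernel_iff]
    exact fun n u => posSemidef_one_add_norm_sub_mul_exp_neg u
  -- At `c = 0` the condition would read `2d ≤ 0`.
  · have hc : 0 < c := by
      refine hc.lt_of_ne fun h0 => ?_
      rw [← h0, Real.zero_rpow (by positivity)] at h
      linarith
    refine ⟨?_, isNonexpansiveKernel_add_norm_sub_sq_rpow_neg hc hd h⟩
    rw [isSymmPosSemidefKernel_scalarKernel_iff]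
    exact fun n u => posSemidef_add_norm_sub_sq_rpow_neg u hc hd
  -- A scalar `L` commutes past `R`, so this is the scalar-times-operator case with the positive
  -- contraction `R R*`.
  · simp only [hcomp]
    refine ⟨hL.scalar_smul (hconj R).1 (hconj R).2, hL'.scalar_smul ?_⟩
    refine (ContinuousLinearMap.opNorm_comp_le _ _).trans (mul_le_one₀ hR (norm_nonneg _) ?_)
    simpa using hR
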